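/- Let $\Lambda$ and $\Gamma$ be left and right noetherian rings, and write $\mathrm{mod}\,\Lambda$ (resp. $\mathrm{mod}\,\Gamma^{op}$) for the category of finitely generated left $\Lambda$-modules (resp. right $\Gamma$-modules). Let ${}_\Lambda U$ be a Wakamatsu tilting module with $\Gamma=\mathrm{End}({}_\Lambda U)$ (acting on $U$ from the right, so that $U$ is a $\Lambda$-$\Gamma$-bimodule). Here ${}_\Lambda U$ is called a Wakamatsu tilting module if it is finitely generated, $\mathrm{Ext}^i_\Lambda(U,U)=0$ for all $i\ge 1$, and there is an exact sequence $0\to\Lambda\to U_0\to U_1\to\cdots$ of left $\Lambda$-modules in which every $U_i$ is a direct summand of a finite direct sum of copies of $U$ and which stays exact after applying $\mathrm{Hom}_\Lambda(-,U)$. For a positive integer $k$, write $U\text{-dom.dim}({}_\Lambda U)\ge k$ if each of the first $k$ terms $E_0,\dots,E_{k-1}$ of a minimal injective resolution $0\to{}_\Lambda U\to E_0\to E_1\to\cdots$ is isomorphic to a direct summand of a direct limit (over a directed set) of $\Lambda$-modules each of which is a finite direct sum of copies of ${}_\Lambda U$; define $U\text{-dom.dim}(U_\Gamma)\ge k$ in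 the same way for the right $\Gamma$-module $U_\Gamma$. For a left $\Lambda$-module or a right $\Gamma$-module $A$, let $A^*$ be $\mathrm{Hom}_\Lambda(A,U)$ (a right $\Gamma$-module) or $\mathrm{Hom}_\Gamma(A,U)$ (a left $\Lambda$-module), respectively, and let $(-)^{**}$ be the resulting double dual functor. Similarly, $\mathrm{Ext}^1_\Lambda(X,U)$ is a right $\Gamma$-module and $\mathrm{Ext}^1_\Gamma(Y,U)$ a left $\Lambda$-module through the action on $U$. Then the following statements are equivalent. 1. $U\text{-dom.dim}({}_\Lambda U)\ge 2$. 2. $(-)^{**}:\mathrm{mod}\,\Lambda\to\mathrm{mod}\,\Lambda$ is left exact. 3. $(-)^{**}:\mathrm{mod}\,\Lambda\to\mathrm{mod}\,\Lambda$ preserves monomorphisms, and $\mathrm{Ext}^1_\Gamma(\mathrm{Ext}^1_\Lambda(X,U),U)=0$ for every $X\in\mathrm{mod}\,\Lambda$. 4. $U\text{-dom.dim}(U_\Gamma)\ge 2$. 5. $(-)^{**}:\mathrm{mod}\,\Gamma^{op}\to\mathrm{mod}\,\Gamma^{op}$ is left exact. 6. $(-)^{**}:\mathrm{mod}\,\Gamma^{op}\to\mathrm{mod}\,\Gamma^{op}$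 preserves monomorphisms, and $\mathrm{Ext}^1_\Lambda(\mathrm{Ext}^1_\Gamma(Y,U),U)=0$ for every $Y\in\mathrm{mod}\,\Gamma^{op}$. -/

import Mathlib

open CategoryTheory

universe u

/-! Throughout, `R` and `S` are rings and `U` carries two commuting left module structures, over `R`
and over `S`.  A bimodule `_ΛU_Γ` is the case `R = Λ`, `S = Γᵐᵒᵖ` (right `Γ`-modules are modules
over `Γᵐᵒᵖ`), and the opposite side is the case `R = Γᵐᵒᵖ`, `S = Λ`. -/

namespace WakamatsuDom

section OneRing

variable (R : Type u) [Ring R]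

/-- `M` is (isomorphic to) a direct summand of `L`. -/
def IsSummand (M L : Type u) [AddCommGroup M] [Module R M] [AddCommGroup L] [Module R L] : Prop :=
  ∃ (s : M →ₗ[R] L) (r : L →ₗ[R] M), r ∘ₗ s = LinearMap.id

/-- `M ∈ add U`: `M` is a direct summand of a finite direct sum of copies of `U`. -/
def InAdd (U M : Type u) [AddCommGroup U] [Module R U] [AddCommGroup M] [Module R M] : Prop :=
  ∃ n : ℕ, IsSummand R M (Fin n → U)

open Classical in
/-- `M ∈ add-lim U`: `M` is a direct summand of a direct limit, over a directed set, of modules each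
of which is a finite direct sum of copies of `U`. -/
def InAddLim (U M : Type u) [AddCommGroup U] [Module R U] [AddCommGroup M] [Module R M] : Prop :=
  ∃ (I : Type u) (_ : Preorder I) (_ : IsDirectedOrder I) (_ : Nonempty I) (n : I → ℕ)
    (f : ∀ i j : I, i ≤ j → (Fin (n i) → U) →ₗ[R] (Fin (n j) → U))
    (_ : DirectedSystem (fun i => Fin (n i) → U) fun i j h => f i j h),
    IsSummand R M (Module.DirectLimit (fun i => Fin (n i) → U) f)

/-- `N` is an essential submodule of `E`. -/
def IsEssential {E : Type u} [AddCommGroup E] [Module R E] (N : Submodule R E) : Prop :=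
  ∀ K : Submodule R E, K ⊓ N = ⊥ → K = ⊥

/-- A minimal injective resolution `0 → M → E₀ → E₁ → ⋯`: an exact sequence with all `Eᵢ` injective,
in which `E₀` is an essential extension of the image of `M` and `Eᵢ₊₁` is an essential extension of
the image of `Eᵢ`. -/
structure MinimalInjectiveResolution (M : Type u) [AddCommGroup M] [Module R M] where
  term : ℕ → Type u
  [addCommGroup : ∀ i, AddCommGroup (term i)]
  [module : ∀ i, Module R (term i)]
  aug : M →ₗ[R] term 0
  d : ∀ i, term i →ₗ[R] term (i + 1)
  injective_term : ∀ i, Module.Injective R (term i)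
  injective_aug : Function.Injective aug
  exact_zero : Function.Exact aug (d 0)
  exact_succ : ∀ i, Function.Exact (d i) (d (i + 1))
  essential_zero : IsEssential R (LinearMap.range aug)
  essential_succ : ∀ i, IsEssential R (LinearMap.range (d i))

attribute [instance] MinimalInjectiveResolution.addCommGroup MinimalInjectiveResolution.module

/-- `U-dom.dim(M) ≥ k`: each of the first `k` terms of a minimal injective resolution of `M` lies in
`add-lim U`.  (Minimal injective resolutions exist and are unique up to isomorphism.) -/
def UDomDimGE (U M : Type u) [AddCommGroup U] [Module R U] [AddCommGroup M] [Module R M]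
    (k : ℕ) : Prop :=
  ∃ E : MinimalInjectiveResolution R M, ∀ i < k, InAddLim R U (E.term i)

/-- An exact sequence `0 → R → T₀ → T₁ → ⋯` with all `Tᵢ ∈ add U` which stays exact
after applying `Hom_R(-, U)`. -/
structure AddCoresolution (U : Type u) [AddCommGroup U] [Module R U] where
  term : ℕ → Type u
  [addCommGroup : ∀ i, AddCommGroup (term i)]
  [module : ∀ i, Module R (term i)]
  aug : R →ₗ[R] term 0
  d : ∀ i, term i →ₗ[R] term (i + 1)
  inAdd_term : ∀ i, InAdd R U (term i)
  injective_aug : Function.Injective aug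
  exact_zero : Function.Exact aug (d 0)
  exact_succ : ∀ i, Function.Exact (d i) (d (i + 1))
  hom_surjective : Function.Surjective fun φ : term 0 →ₗ[R] U => φ ∘ₗ aug
  hom_exact_zero : Function.Exact
    (fun φ : term 1 →ₗ[R] U => φ ∘ₗ d 0) (fun φ : term 0 →ₗ[R] U => φ ∘ₗ aug)
  hom_exact_succ : ∀ i, Function.Exact
    (fun φ : term (i + 1 + 1) →ₗ[R] U => φ ∘ₗ d (i + 1))
    (fun φ : term (i + 1) →ₗ[R] U => φ ∘ₗ d i)

/-- `U` is a Wakamatsu tilting `R`-module. -/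
structure IsWakamatsuTilting (U : Type u) [AddCommGroup U] [Module R U] : Prop where
  finite : Module.Finite R U
  selfOrthogonal : ∀ i : ℕ, 1 ≤ i →
    Subsingleton (Abelian.Ext (ModuleCat.of R U) (ModuleCat.of R U) i)
  coresolution : Nonempty (AddCoresolution R U)

end OneRing

section TwoRings

variable (R S : Type u) [Ring R] [Ring S] (U : Type u) [AddCommGroup U] [Module R U] [Module S U]
  [SMulCommClass R S U] [SMulCommClass S R U]

/-- `Extⁿ_R(X, U)`, to be regarded as a module over every ring `S` whose
action on `U` commutes with that of `R`. -/
def ExtU (X : Type u) [AddCommGroup X] [Module R X] (n : ℕ) : Type u :=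
  Abelian.Ext (ModuleCat.of R X) (ModuleCat.of R U) n

section

variable (X : Type u) [AddCommGroup X] [Module R X] (n : ℕ)

noncomputable instance : AddCommGroup (ExtU R U X n) :=
  inferInstanceAs (AddCommGroup (Abelian.Ext (ModuleCat.of R X) (ModuleCat.of R U) n))

/-- Multiplication by `s : S` as a morphism of `R`-modules `U ⟶ U`. -/
noncomputable def actHom (s : S) : ModuleCat.of R U ⟶ ModuleCat.of R U :=
  ModuleCat.ofHom (Module.toModuleEnd R (S := S) U s)

/-- `s : S` acts on `Extⁿ_R(X, U)` by functoriality in `U`, that is, by composition with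
multiplication by `s` on `U`. -/
noncomputable def extAct :
    S →+* AddMonoid.End (Abelian.Ext (ModuleCat.of R X) (ModuleCat.of R U) n) where
  toFun s :=
    { toFun := fun e => e.comp (Abelian.Ext.mk₀ (actHom R S U s)) (add_zero n)
      map_zero' := Abelian.Ext.zero_comp ..
      map_add' := fun e e' => Abelian.Ext.add_comp .. }
  map_one' := by
    have h : actHom R S U 1 = 𝟙 (ModuleCat.of R U) := by
      rw [actHom, map_one]; rfl
    refine AddMonoidHom.ext fun e => ?_
    change e.comp (Abelian.Ext.mk₀ (actHom R S U 1)) (add_zero n) = e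
    rw [h, Abelian.Ext.comp_mk₀_id]
  map_zero' := by
    have h : actHom R S U 0 = 0 := by
      rw [actHom, map_zero]; rfl
    refine AddMonoidHom.ext fun e => ?_
    change e.comp (Abelian.Ext.mk₀ (actHom R S U 0)) (add_zero n) = 0
    rw [h, Abelian.Ext.mk₀_zero, Abelian.Ext.comp_zero]
  map_mul' s t := by
    have h : actHom R S U (s * t) = actHom R S U t ≫ actHom R S U s := by
      rw [actHom, map_mul]; rfl
    refine AddMonoidHom.ext fun e => ?_
    change e.comp (Abelian.Ext.mk₀ (actHom R S U (s * t))) (add_zero n) =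
      (e.comp (Abelian.Ext.mk₀ (actHom R S U t)) (add_zero n)).comp
        (Abelian.Ext.mk₀ (actHom R S U s)) (add_zero n)
    rw [Abelian.Ext.comp_assoc_of_third_deg_zero, Abelian.Ext.mk₀_comp_mk₀, h]
  map_add' s t := by
    have h : actHom R S U (s + t) = actHom R S U s + actHom R S U t := by
      rw [actHom, map_add]; rfl
    refine AddMonoidHom.ext fun e => ?_
    change e.comp (Abelian.Ext.mk₀ (actHom R S U (s + t))) (add_zero n) =
      e.comp (Abelian.Ext.mk₀ (actHom R S U s)) (add_zero n) +
        e.comp (Abelian.Ext.mk₀ (actHom R S U t)) (add_zero n)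
    rw [h, Abelian.Ext.mk₀_add, Abelian.Ext.comp_add]

noncomputable instance : Module S (ExtU R U X n) :=
  Module.compHom (Abelian.Ext (ModuleCat.of R X) (ModuleCat.of R U) n) (extAct R S U X n)

end

/-- `f** : A** → B**`, where `A** = Hom_S(Hom_R(A, U), U)`. -/
def doubleDualMap {A B : Type u} [AddCommGroup A] [Module R A] [AddCommGroup B] [Module R B]
    (f : A →ₗ[R] B) : ((A →ₗ[R] U) →ₗ[S] U) →ₗ[R] ((B →ₗ[R] U) →ₗ[S] U) :=
  LinearMap.lcomp R U (LinearMap.lcomp S U f)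

/-- `(-)**` preserves monomorphisms between finitely generated `R`-modules. -/
def DoubleDualPreservesMono : Prop :=
  ∀ (A B : Type u) [AddCommGroup A] [Module R A] [Module.Finite R A]
    [AddCommGroup B] [Module R B] [Module.Finite R B] (f : A →ₗ[R] B),
    Function.Injective f → Function.Injective (doubleDualMap R S U f)

/-- `(-)**` is left exact on finitely generated `R`-modules: it takes every exact sequence
`0 → A → B → C` to an exact sequence `0 → A** → B** → C**`. -/
def DoubleDualLeftExact : Prop :=
  ∀ (A B C : Type u) [AddCommGroup A] [Module R A] [Module.Finite R A]
    [AddCommGroup B] [Module R B] [Module.Finite R B]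
    [AddCommGroup C] [Module R C] [Module.Finite R C] (f : A →ₗ[R] B) (g : B →ₗ[R] C),
    Function.Injective f → Function.Exact f g →
      Function.Injective (doubleDualMap R S U f) ∧
        Function.Exact (doubleDualMap R S U f) (doubleDualMap R S U g)

/-- `Ext¹_S(Ext¹_R(X, U), U) = 0` for every finitely generated `R`-module `X`. -/
def ExtExtVanishes : Prop :=
  ∀ (X : Type u) [AddCommGroup X] [Module R X] [Module.Finite R X],
    Subsingleton (Abelian.Ext (ModuleCat.of S (ExtU R U X 1)) (ModuleCat.of S U) 1)

end TwoRings

end WakamatsuDom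

set_option linter.unusedSectionVars false

/-! Write R and S for the two rings. Everything reduces to two conditions on one side: (a)
submodules of the reject of `U` in a finitely generated module have zero `U`-dual
(`RejectDualVanishes`); (b) finitely generated modules with zero `U`-dual have no `Ext¹` into `U`
(`ExtVanishesOfDualZero`).

An injective module lies in `add-lim U` exactly when maps into it from finitely generated modules
kill rejects. By essentiality and lifting along `E₀ → E₁`, this holds for both `E₀` and `E₁` iff (a)
and (b) hold (`uDomDimGE_two_iff`).

The sides are exchanged by duality. Left exactness of `(-)**` on R-modules forces (a) and (b) over
R, whereas (a) and (b) over S force left exactness on R-modules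
(`leftExact_of_extVanishesOfDualZero`). Going back and forth shows that the conditions over R and
over S agree. The `Ext¹(Ext¹)` statements come in because finitely generated S-modules with zero
dual are all of the form `Ext¹_R(X, U)` (`exists_equiv_extU`).

The Wakamatsu hypothesis serves to make the setting symmetric: `U` is finitely generated on both
sides, faithfully balanced, and has no first self-extension on either side
(`IsWakamatsuTilting.isDualizing`). -/

namespace WakamatsuDom

/-! ### `Ext¹` into `U` and extension of maps -/

section ExtOne

variable {R : Type u} [Ring R] {A B C U : Type u} [AddCommGroup A] [Module R A]
  [AddCommGroup B] [Module R B] [AddCommGroup C] [Module R C] [AddCommGroup U] [Module R U]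

/-- The class of a short exact sequence `0 → A → B → C → 0`, with the exactness of
`Hom(B, U) → Hom(A, U) → Ext¹(C, U) → Ext¹(B, U)`. -/
lemma exists_extClass {f : A →ₗ[R] B} {g : B →ₗ[R] C}
    (hf : Function.Injective f) (h : Function.Exact f g) (hg : Function.Surjective g) :
    ∃ e : Abelian.Ext (ModuleCat.of R C) (ModuleCat.of R A) 1,
      (∀ φ : A →ₗ[R] U, e.comp (Abelian.Ext.mk₀ (ModuleCat.ofHom φ)) (add_zero 1) = 0 ↔
        ∃ ψ : B →ₗ[R] U, ψ ∘ₗ f = φ) ∧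
      (Subsingleton (Abelian.Ext (ModuleCat.of R B) (ModuleCat.of R U) 1) →
        ∀ x : Abelian.Ext (ModuleCat.of R C) (ModuleCat.of R U) 1, ∃ φ : A →ₗ[R] U,
          e.comp (Abelian.Ext.mk₀ (ModuleCat.ofHom φ)) (add_zero 1) = x) := by
  have hS : (ShortComplex.moduleCatMk f g h.linearMap_comp_eq_zero).ShortExact :=
    { exact := (ShortComplex.ShortExact.moduleCat_exact_iff_function_exact _).mpr h
      mono_f := (ModuleCat.mono_iff_injective _).2 hf
      epi_g := (ModuleCat.epi_iff_surjective _).2 hg }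
  refine ⟨hS.extClass, fun φ => ⟨fun hφ => ?_, ?_⟩, fun hB x => ?_⟩
  · obtain ⟨x, hx⟩ := Abelian.Ext.contravariant_sequence_exact₁ hS (Y := ModuleCat.of R U)
      (Abelian.Ext.mk₀ (ModuleCat.ofHom φ)) (add_zero 1) hφ
    obtain ⟨ψ, rfl⟩ := (Abelian.Ext.mk₀_bijective _ _).2 x
    rw [Abelian.Ext.mk₀_comp_mk₀] at hx
    exact ⟨ψ.hom, congrArg ModuleCat.Hom.hom ((Abelian.Ext.mk₀_bijective _ _).1 hx)⟩
  · rintro ⟨ψ, rfl⟩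
    exact (congrArg (fun y => hS.extClass.comp y (add_zero 1))
      (Abelian.Ext.mk₀_comp_mk₀ (ModuleCat.ofHom f) (ModuleCat.ofHom ψ)).symm).trans
      (hS.extClass_comp_assoc (Abelian.Ext.mk₀ (ModuleCat.ofHom ψ)))
  · obtain ⟨y, hy⟩ := Abelian.Ext.contravariant_sequence_exact₃ hS (Y := ModuleCat.of R U) x
      (hB.elim _ _) (add_zero 1)
    obtain ⟨φ, rfl⟩ := (Abelian.Ext.mk₀_bijective _ _).2 y
    exact ⟨φ.hom, hy⟩

/-- If `Ext¹(C, U) = 0`, then maps to `U` extend along `A → B` with cokernel `C`. -/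
lemma exists_extension_of_ext_subsingleton
    (hC : Subsingleton (Abelian.Ext (ModuleCat.of R C) (ModuleCat.of R U) 1))
    {f : A →ₗ[R] B} {g : B →ₗ[R] C} (hf : Function.Injective f) (h : Function.Exact f g)
    (hg : Function.Surjective g) (φ : A →ₗ[R] U) : ∃ ψ : B →ₗ[R] U, ψ ∘ₗ f = φ := by
  obtain ⟨e, he, -⟩ := exists_extClass (U := U) hf h hg
  exact (he φ).1 (hC.elim _ _)

/-- If `B` is projective and maps to `U` extend along `A → B`, then `Ext¹(C, U) = 0`. -/
lemma ext_subsingleton_of_extension [Module.Projective R B]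
    {f : A →ₗ[R] B} {g : B →ₗ[R] C} (hf : Function.Injective f) (h : Function.Exact f g)
    (hg : Function.Surjective g) (H : ∀ φ : A →ₗ[R] U, ∃ ψ : B →ₗ[R] U, ψ ∘ₗ f = φ) :
    Subsingleton (Abelian.Ext (ModuleCat.of R C) (ModuleCat.of R U) 1) := by
  have : Projective (ModuleCat.of R B) := (IsProjective.iff_projective B).1 inferInstance
  obtain ⟨e, he, he'⟩ := exists_extClass (U := U) hf h hg
  refine subsingleton_of_forall_eq 0 fun x => ?_
  obtain ⟨φ, rfl⟩ := he' (Abelian.Ext.subsingleton_of_projective _ _ 0) x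
  exact (he φ).2 (H φ)

/-- `Ext` out of a finite power vanishes when `Ext` out of the module vanishes. -/
lemma ext_pow_subsingleton (hA : Subsingleton
    (Abelian.Ext (ModuleCat.of R A) (ModuleCat.of R U) 1)) (n : ℕ) :
    Subsingleton (Abelian.Ext (ModuleCat.of R (Fin n → A)) (ModuleCat.of R U) 1) := by
  refine subsingleton_of_forall_eq 0 fun x => ?_
  have hid : 𝟙 (ModuleCat.of R (Fin n → A)) = ∑ i : Fin n,
      ModuleCat.ofHom (LinearMap.proj (R := R) (φ := fun _ : Fin n => A) i) ≫
        ModuleCat.ofHom (LinearMap.single R (fun _ : Fin n => A) i) := by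
    refine ModuleCat.hom_ext (LinearMap.ext fun y => ?_)
    rw [ModuleCat.hom_sum]
    simp only [LinearMap.sum_apply]
    exact (LinearMap.sum_single_apply _ y).symm
  rw [← Abelian.Ext.mk₀_id_comp x, hid, Abelian.Ext.mk₀_sum, Abelian.Ext.sum_comp]
  refine Finset.sum_eq_zero fun i _ => ?_
  rw [← Abelian.Ext.mk₀_comp_mk₀_assoc]
  rw [hA.elim ((Abelian.Ext.mk₀ _).comp x _) 0, Abelian.Ext.comp_zero]

variable (S : Type u) [Ring S] [Module S U] [SMulCommClass R S U] [SMulCommClass S R U]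

/-- If `Ext¹(B, U) = 0`, then `Ext¹(C, U)` is the cokernel of `Hom(B, U) → Hom(A, U)`, as a module
over every ring that acts on `U`. -/
lemma exists_connecting_map
    (hB : Subsingleton (Abelian.Ext (ModuleCat.of R B) (ModuleCat.of R U) 1))
    {f : A →ₗ[R] B} {g : B →ₗ[R] C} (hf : Function.Injective f) (h : Function.Exact f g)
    (hg : Function.Surjective g) :
    ∃ δ : (A →ₗ[R] U) →ₗ[S] ExtU R U C 1, Function.Surjective δ ∧
      ∀ φ, δ φ = 0 ↔ ∃ ψ : B →ₗ[R] U, ψ ∘ₗ f = φ := by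
  obtain ⟨e, he, he'⟩ := exists_extClass (U := U) hf h hg
  exact ⟨{
    toFun := fun φ => e.comp (Abelian.Ext.mk₀ (ModuleCat.ofHom φ)) (add_zero 1)
    map_add' := fun φ φ' => by
      rw [ModuleCat.ofHom_add, Abelian.Ext.mk₀_add, Abelian.Ext.comp_add]
      rfl
    map_smul' := fun s φ => by
      have : ModuleCat.ofHom (s • φ) = ModuleCat.ofHom φ ≫ actHom R S U s := rfl
      rw [this, ← Abelian.Ext.mk₀_comp_mk₀, ← Abelian.Ext.comp_assoc_of_third_deg_zero]
      rfl }, he' hB, he⟩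

end ExtOne

/-! ### Factoring linear maps and finite presentations -/

section Factor

variable {R : Type*} [Ring R] {A B C : Type*} [AddCommGroup A] [Module R A]
  [AddCommGroup B] [Module R B] [AddCommGroup C] [Module R C]

lemma exists_factor_of_surjective {j : A →ₗ[R] B} (hj : Function.Surjective j) (a : A →ₗ[R] C)
    (h : ∀ x, j x = 0 → a x = 0) : ∃ g : B →ₗ[R] C, ∀ x, g (j x) = a x := by
  refine ⟨(LinearMap.ker j).liftQ a (fun x hx => h x hx) ∘ₗ
    (j.quotKerEquivOfSurjective hj).symm.toLinearMap, fun x => ?_⟩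
  have : (j.quotKerEquivOfSurjective hj).symm (j x) = (LinearMap.ker j).mkQ x := by
    rw [LinearEquiv.symm_apply_eq]
    rfl
  rw [LinearMap.comp_apply, LinearEquiv.coe_coe, this]
  rfl

lemma exists_factor_of_injective {j : B →ₗ[R] C} (hj : Function.Injective j) (a : A →ₗ[R] C)
    (h : ∀ x, ∃ y, j y = a x) : ∃ g : A →ₗ[R] B, ∀ x, j (g x) = a x := by
  choose g hg using h
  exact ⟨{
    toFun := g
    map_add' := fun x y => hj (by simp [hg])
    map_smul' := fun r x => hj (by simp [hg]) }, hg⟩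

lemma eq_sum_single {n : ℕ} (f : (Fin n → R) →ₗ[R] A) (y : Fin n → R) :
    f y = ∑ i, y i • f (Pi.single i 1) := by
  conv_lhs => rw [pi_eq_sum_univ' y, map_sum]
  simp [map_smul]

/-- A submodule of a finitely generated module over a noetherian ring is the image of a finitely
generated free module. -/
lemma exists_free_range_eq [IsNoetherianRing R] [Module.Finite R A] (N : Submodule R A) :
    ∃ (k : ℕ) (ρ : (Fin k → R) →ₗ[R] A), LinearMap.range ρ = N := by
  obtain ⟨k, ρ, hρ⟩ := Module.Finite.exists_fin' R N
  exact ⟨k, N.subtype ∘ₗ ρ, by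
    rw [LinearMap.range_comp_of_range_eq_top _ (LinearMap.range_eq_top.2 hρ), N.range_subtype]⟩

end Factor

/-! ### Rejects and the two one-sided conditions -/

section Reject

variable (R : Type u) [Ring R] (U : Type u) [AddCommGroup U] [Module R U]

/-- The reject of `U` in `N`: the elements killed by all maps `N → U`. -/
def reject (N : Type u) [AddCommGroup N] [Module R N] : Submodule R N :=
  ⨅ f : N →ₗ[R] U, LinearMap.ker f

variable {R U} in
lemma mem_reject {N : Type u} [AddCommGroup N] [Module R N] {x : N} :
    x ∈ reject R U N ↔ ∀ f : N →ₗ[R] U, f x = 0 := by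
  simp [reject]

/-- Submodules of rejects of `U` in finitely generated modules have zero `U`-dual. -/
def RejectDualVanishes : Prop :=
  ∀ (N : Type u) [AddCommGroup N] [Module R N] [Module.Finite R N] (X : Submodule R N),
    X ≤ reject R U N → ∀ g : X →ₗ[R] U, g = 0

/-- Finitely generated modules `X` with zero `U`-dual satisfy `Ext¹(X, U) = 0`. -/
def ExtVanishesOfDualZero : Prop :=
  ∀ (X : Type u) [AddCommGroup X] [Module R X] [Module.Finite R X],
    (∀ g : X →ₗ[R] U, g = 0) →
      Subsingleton (Abelian.Ext (ModuleCat.of R X) (ModuleCat.of R U) 1)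

end Reject

/-- `U` is a finitely generated self-orthogonal faithfully balanced bimodule. -/
structure IsDualizing (R S : Type u) [Ring R] [Ring S] (U : Type u) [AddCommGroup U] [Module R U]
    [Module S U] [SMulCommClass R S U] [SMulCommClass S R U] : Prop where
  finite_left : Module.Finite R U
  finite_right : Module.Finite S U
  bijective_left : Function.Bijective (Module.toModuleEnd S (S := R) U)
  bijective_right : Function.Bijective (Module.toModuleEnd R (S := S) U)
  ext_left : Subsingleton (Abelian.Ext (ModuleCat.of R U) (ModuleCat.of R U) 1)
  ext_right : Subsingleton (Abelian.Ext (ModuleCat.of S U) (ModuleCat.of S U) 1)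

/-! ### Duality for powers of `U`; monomorphisms under the double dual -/

section Duality

variable {R S : Type u} [Ring R] [Ring S] {U : Type u} [AddCommGroup U] [Module R U] [Module S U]
  [SMulCommClass R S U] [SMulCommClass S R U]

lemma IsDualizing.symm (h : IsDualizing R S U) : IsDualizing S R U :=
  ⟨h.finite_right, h.finite_left, h.bijective_right, h.bijective_left, h.ext_right, h.ext_left⟩

/-- Every `R`-linear map `Uⁿ → U` is given by scalars in `S` if `S → End_R(U)` is onto. -/
lemma exists_scalars (h : Function.Surjective (Module.toModuleEnd R (S := S) U)) {n : ℕ}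
    (k : (Fin n → U) →ₗ[R] U) : ∃ s : Fin n → S, ∀ y, k y = ∑ i, s i • y i := by
  choose s hs using fun i => h (k ∘ₗ LinearMap.single R (fun _ : Fin n => U) i)
  refine ⟨s, fun y => ?_⟩
  rw [← LinearMap.sum_single_apply (fun _ : Fin n => U) y, map_sum]
  refine Finset.sum_congr rfl fun i _ => ?_
  rw [LinearMap.sum_single_apply]
  exact (LinearMap.congr_fun (hs i) (y i)).symm

lemma eq_zero_of_forall_smul (h : Function.Injective (Module.toModuleEnd R (S := S) U)) {s : S}
    (hs : ∀ u : U, s • u = 0) : s = 0 :=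
  h (by rw [map_zero]; exact LinearMap.ext hs)

/-- Finitely generated powers of `U` are reflexive. -/
lemma exists_eval_pow (h : Function.Surjective (Module.toModuleEnd R (S := S) U)) {n : ℕ}
    (G : ((Fin n → U) →ₗ[R] U) →ₗ[S] U) : ∃ y, ∀ k, G k = k y := by
  refine ⟨fun i => G (LinearMap.proj i), fun k => ?_⟩
  obtain ⟨s, hs⟩ := exists_scalars h k
  have : k = ∑ i, s i • LinearMap.proj (R := R) (φ := fun _ : Fin n => U) i :=
    LinearMap.ext fun y => by simp [hs]
  conv_lhs => rw [this]
  simp [hs]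

lemma exists_pow_equiv_dual_pow (h : Function.Bijective (Module.toModuleEnd R (S := S) U)) (n : ℕ) :
    ∃ τ : (Fin n → S) ≃ₗ[S] ((Fin n → U) →ₗ[R] U), ∀ s y, τ s y = ∑ i, s i • y i := by
  let τ : (Fin n → S) →ₗ[S] ((Fin n → U) →ₗ[R] U) :=
    ∑ i, LinearMap.toSpanSingleton S _ (LinearMap.proj (R := R) (φ := fun _ => U) i) ∘ₗ
      LinearMap.proj i
  have hτ : ∀ s y, τ s y = ∑ i, s i • y i := fun s y => by simp [τ]
  refine ⟨LinearEquiv.ofBijective τ ⟨?_, fun φ => ?_⟩, hτ⟩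
  · rw [injective_iff_map_eq_zero]
    intro s hs
    funext i
    refine eq_zero_of_forall_smul h.1 fun u => ?_
    have := hτ s (Pi.single i u)
    rw [hs] at this
    simpa [Pi.single_apply, smul_ite] using this.symm
  · obtain ⟨s, hs⟩ := exists_scalars h.2 φ
    exact ⟨s, LinearMap.ext fun y => by rw [hτ, hs]⟩

variable (S) in
/-- Evaluation at generators embeds the dual of a finitely generated module in a power of `U`. -/
def evalGenerators {A : Type u} [AddCommGroup A] [Module R A] {k : ℕ} (q : (Fin k → R) →ₗ[R] A) :
    (A →ₗ[R] U) →ₗ[S] (Fin k → U) where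
  toFun φ i := φ (q (Pi.single i 1))
  map_add' _ _ := rfl
  map_smul' _ _ := rfl

lemma sum_smul_evalGenerators {A : Type u} [AddCommGroup A] [Module R A] {k : ℕ}
    (q : (Fin k → R) →ₗ[R] A) (φ : A →ₗ[R] U) (r : Fin k → R) :
    ∑ i, r i • evalGenerators S q φ i = φ (q r) := by
  rw [eq_sum_single q r, map_sum]
  simp [evalGenerators]

lemma finite_dual [IsNoetherianRing S] (hU : Module.Finite S U) (A : Type u) [AddCommGroup A]
    [Module R A] [Module.Finite R A] : Module.Finite S (A →ₗ[R] U) := by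
  obtain ⟨k, q, hq⟩ := Module.Finite.exists_fin' R A
  refine Module.Finite.of_injective (evalGenerators S q) ?_
  intro φ ψ hφ
  refine LinearMap.ext fun a => ?_
  obtain ⟨r, rfl⟩ := hq a
  rw [← sum_smul_evalGenerators (S := S), hφ, sum_smul_evalGenerators]

/-- Evaluation at a point of `X` is an element of `X**` that dies in `N**`, since all maps `N → U`
kill the reject; hence it is already zero. -/
lemma rejectDualVanishes_of_preservesMono [IsNoetherianRing R]
    (h : DoubleDualPreservesMono R S U) : RejectDualVanishes R U := by
  intro N _ _ _ X hX g
  refine LinearMap.ext fun x => ?_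
  let ev : (X →ₗ[R] U) →ₗ[S] U := ⟨⟨fun φ => φ x, fun _ _ => rfl⟩, fun _ _ => rfl⟩
  have : ev = 0 := h X N X.subtype X.injective_subtype <| by
    rw [map_zero]
    exact LinearMap.ext fun φ => mem_reject.1 (hX x.2) φ
  exact LinearMap.congr_fun this g

/-- An element of the kernel of `f**` is a map `A* → U` vanishing on restrictions from `B*`. The
cokernel of `B* → A*` embeds in a quotient of a power of `U`, and faithful balance places it inside
the reject there, so it has zero dual. -/
lemma preservesMono_of_rejectDualVanishes [IsNoetherianRing R] (hU : IsDualizing R S U)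
    (h : RejectDualVanishes S U) : DoubleDualPreservesMono R S U := by
  intro A B _ _ _ _ _ _ f hf
  rw [injective_iff_map_eq_zero]
  intro a ha
  have hfin := hU.finite_right
  obtain ⟨m, π, hπ⟩ := Module.Finite.exists_fin' R B
  obtain ⟨k, ρ, hρ⟩ := exists_free_range_eq ((LinearMap.range f).comap π)
  have hρ' : ∀ c, ∃ y, f y = π (ρ c) := fun c =>
    (hρ.le (LinearMap.mem_range_self ρ c) : ρ c ∈ (LinearMap.range f).comap π)
  obtain ⟨q, hq⟩ := exists_factor_of_injective hf (π ∘ₗ ρ) hρ'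
  have hq_surj : Function.Surjective q := fun y => by
    obtain ⟨p, hp⟩ := hπ (f y)
    obtain ⟨c, rfl⟩ : p ∈ LinearMap.range ρ := hρ.ge (by simp [hp])
    exact ⟨c, hf (by rw [hq]; exact hp)⟩
  -- `K` is the image of the dual of `R^m` under `ρ`. A map from `U^k / K` to `U` is given by a
  -- relation `r` with `ρ r = 0`; then `q r = 0`, so it kills the image of `A*`.
  let K := LinearMap.range (evalGenerators (U := U) S ρ)
  let j : (A →ₗ[R] U) →ₗ[S] ((Fin k → U) ⧸ K) := K.mkQ ∘ₗ evalGenerators S q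
  have hj : LinearMap.range j ≤ reject S U ((Fin k → U) ⧸ K) := by
    rintro _ ⟨φ, rfl⟩
    refine mem_reject.2 fun F => ?_
    obtain ⟨r, hr⟩ := exists_scalars hU.bijective_left.2 (F ∘ₗ K.mkQ)
    have h0 : ρ r = 0 := by
      funext l
      refine eq_zero_of_forall_smul hU.bijective_left.1 fun u => ?_
      let ψ : (Fin m → R) →ₗ[R] U := LinearMap.toSpanSingleton R U u ∘ₗ LinearMap.proj l
      have h1 := hr (evalGenerators S ρ ψ)
      rw [sum_smul_evalGenerators] at h1
      rw [show ρ r l • u = ψ (ρ r) from rfl, ← h1, LinearMap.comp_apply,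
        show K.mkQ (evalGenerators S ρ ψ) = 0 from (Submodule.Quotient.mk_eq_zero K).2 ⟨ψ, rfl⟩,
        map_zero]
    have h2 : q r = 0 := hf (by rw [hq, LinearMap.comp_apply, h0, map_zero, map_zero])
    have h3 := hr (evalGenerators S q φ)
    rw [sum_smul_evalGenerators, h2, map_zero] at h3
    exact h3
  -- The kernel of `j` consists of restrictions from `B`: if `φ` and `ψ` agree on generators, then
  -- `ψ` kills `ker π` and descends to `B`.
  obtain ⟨g, hg⟩ := exists_factor_of_surjective (LinearMap.surjective_rangeRestrict j) a <| by
    intro φ hφ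
    have : j φ = 0 := congrArg Subtype.val hφ
    obtain ⟨ψ, hψ⟩ := (Submodule.Quotient.mk_eq_zero K).1 this
    have hψ' : ∀ c, ψ (ρ c) = φ (q c) := fun c => by
      rw [← sum_smul_evalGenerators (S := S), hψ, sum_smul_evalGenerators]
    obtain ⟨χ, hχ⟩ := exists_factor_of_surjective hπ ψ <| by
      intro p hp
      obtain ⟨c, rfl⟩ : p ∈ LinearMap.range ρ := hρ.ge (by simp [hp])
      have : q c = 0 := hf (by rw [hq, LinearMap.comp_apply, hp, map_zero])
      rw [hψ', this, map_zero]
    have : φ = χ ∘ₗ f := LinearMap.ext fun y => by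
      obtain ⟨c, rfl⟩ := hq_surj y
      rw [LinearMap.comp_apply, hq, LinearMap.comp_apply, hχ, hψ']
    rw [this]
    exact LinearMap.congr_fun ha χ
  refine LinearMap.ext fun φ => ?_
  rw [← hg, h _ _ hj g]
  rfl

end Duality

/-! ### Left exactness of the double dual and `Ext¹` of modules with zero dual -/

section LeftExact

variable {R S : Type u} [Ring R] [Ring S] {U : Type u} [AddCommGroup U] [Module R U] [Module S U]
  [SMulCommClass R S U] [SMulCommClass S R U]

variable (R S U) in
/-- The evaluation map `A → A**`. -/
def evalDual (A : Type u) [AddCommGroup A] [Module R A] : A →ₗ[R] ((A →ₗ[R] U) →ₗ[S] U) where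
  toFun x := ⟨⟨fun φ => φ x, fun _ _ => rfl⟩, fun _ _ => rfl⟩
  map_add' x y := LinearMap.ext fun φ => map_add φ x y
  map_smul' r x := LinearMap.ext fun φ => map_smul φ r x

lemma preservesMono_of_leftExact (h : DoubleDualLeftExact R S U) :
    DoubleDualPreservesMono R S U := by
  intro A B _ _ _ _ _ _ f hf
  exact (h A B (B ⧸ LinearMap.range f) f (LinearMap.range f).mkQ hf
    (LinearMap.exact_map_mkQ_range f)).1

/-- For a free cover with kernel `K` and `X* = 0`, left exactness makes `K** → (R^m)**` an
isomorphism. A map `φ : K → U` then extends as `R^m → (R^m)** ≅ K** → U`, the last map being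
evaluation at `φ`. -/
lemma extVanishesOfDualZero_of_leftExact [IsNoetherianRing R] (h : DoubleDualLeftExact R S U) :
    ExtVanishesOfDualZero R U := by
  intro X _ _ _ hX
  obtain ⟨m, π, hπ⟩ := Module.Finite.exists_fin' R X
  let i := (LinearMap.ker π).subtype
  have hi : Function.Injective i := (LinearMap.ker π).injective_subtype
  have hex : Function.Exact i π := LinearMap.exact_subtype_ker_map π
  obtain ⟨h1, h2⟩ := h _ _ _ i π hi hex
  have hsurj : Function.Surjective (doubleDualMap R S U i) := fun p =>
    (h2 p).1 (LinearMap.ext fun φ => by rw [hX φ, map_zero, map_zero])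
  refine ext_subsingleton_of_extension hi hex hπ fun φ => ?_
  let e := LinearEquiv.ofBijective _ ⟨h1, hsurj⟩
  let evφ : ((LinearMap.ker π →ₗ[R] U) →ₗ[S] U) →ₗ[R] U :=
    ⟨⟨fun a => a φ, fun _ _ => rfl⟩, fun _ _ => rfl⟩
  refine ⟨evφ ∘ₗ e.symm.toLinearMap ∘ₗ evalDual R S U (Fin m → R), LinearMap.ext fun x => ?_⟩
  have : e.symm (evalDual R S U (Fin m → R) (i x)) = evalDual R S U _ x :=
    (LinearEquiv.symm_apply_eq _).2 rfl
  change evφ (e.symm (evalDual R S U (Fin m → R) (i x))) = φ x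
  rw [this]
  rfl

/-- If `b` in `B**` dies in `C**`, it factors through the image `I` of `B* → A*`. The dual of `A* /
I` is the kernel of `f**`, which is zero, so `Ext¹(A* / I, U) = 0` and `b` extends to an element of
`A**`. -/
lemma leftExact_of_extVanishesOfDualZero [IsNoetherianRing R] [IsNoetherianRing S]
    (hU : IsDualizing R S U) (h1 : RejectDualVanishes S U) (h2 : ExtVanishesOfDualZero S U) :
    DoubleDualLeftExact R S U := by
  have hmono := preservesMono_of_rejectDualVanishes hU h1
  intro A B C _ _ _ _ _ _ _ _ _ f g hf hfg
  refine ⟨hmono A B f hf, fun b => ⟨fun hb => ?_, ?_⟩⟩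
  · let T : (B →ₗ[R] U) →ₗ[S] (A →ₗ[R] U) := LinearMap.lcomp S U f
    let I := LinearMap.range T
    obtain ⟨b', hb'⟩ := exists_factor_of_surjective (LinearMap.surjective_rangeRestrict T) b <| by
      intro φ hφ
      have hφ' : φ ∘ₗ f = 0 := congrArg Subtype.val hφ
      -- A map that vanishes on `A` comes from the image of `g`, not from all of `C`; preservation
      -- of `D → C` compensates for this.
      let D := LinearMap.range g
      have hD := hmono D C D.subtype D.injective_subtype
      have : doubleDualMap R S U g.rangeRestrict b = 0 := hD (by rw [map_zero, ← hb]; rfl)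
      obtain ⟨χ, hχ⟩ := exists_factor_of_surjective g.surjective_rangeRestrict φ <| by
        intro x hx
        obtain ⟨y, rfl⟩ := (hfg x).1 (congrArg Subtype.val hx)
        exact LinearMap.congr_fun hφ' y
      rw [show φ = χ ∘ₗ g.rangeRestrict from LinearMap.ext fun x => (hχ x).symm]
      exact LinearMap.congr_fun this χ
    have hfin := finite_dual (R := R) hU.finite_right A
    have hW : ∀ w : ((A →ₗ[R] U) ⧸ I) →ₗ[S] U, w = 0 := fun w => by
      have : w ∘ₗ I.mkQ = 0 := hmono A B f hf <| by
        rw [map_zero]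
        refine LinearMap.ext fun φ => ?_
        change w (I.mkQ (T φ)) = 0
        rw [show I.mkQ (T φ) = 0 from (Submodule.Quotient.mk_eq_zero I).2 ⟨φ, rfl⟩, map_zero]
      refine LinearMap.ext fun x => ?_
      obtain ⟨x, rfl⟩ := I.mkQ_surjective x
      exact LinearMap.congr_fun this x
    obtain ⟨a, ha⟩ := exists_extension_of_ext_subsingleton (h2 _ hW) I.injective_subtype
      (LinearMap.exact_subtype_mkQ I) I.mkQ_surjective b'
    refine ⟨a, LinearMap.ext fun φ => ?_⟩
    rw [← hb' φ, ← ha]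
    rfl
  · rintro ⟨a, rfl⟩
    refine LinearMap.ext fun φ => ?_
    change a ((φ ∘ₗ g) ∘ₗ f) = 0
    rw [LinearMap.comp_assoc, hfg.linearMap_comp_eq_zero, LinearMap.comp_zero, map_zero]

/-- `Ext¹(X, U)` is the cokernel of the dual of `K → R^m`, so its own dual is the kernel of `K** →
(R^m)**`, which vanishes. -/
lemma extExtVanishes_of_extVanishesOfDualZero [IsNoetherianRing R] [IsNoetherianRing S]
    (hU : IsDualizing R S U) (h1 : DoubleDualPreservesMono R S U)
    (h2 : ExtVanishesOfDualZero S U) : ExtExtVanishes R S U := by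
  intro X _ _ _
  obtain ⟨m, π, hπ⟩ := Module.Finite.exists_fin' R X
  let i := (LinearMap.ker π).subtype
  have hi : Function.Injective i := (LinearMap.ker π).injective_subtype
  have : Projective (ModuleCat.of R (Fin m → R)) :=
    (IsProjective.iff_projective (Fin m → R)).1 inferInstance
  obtain ⟨δ, hδ, hδ'⟩ := exists_connecting_map (U := U) S
    (Abelian.Ext.subsingleton_of_projective _ _ 0) hi (LinearMap.exact_subtype_ker_map π) hπ
  have hfin := finite_dual (R := R) hU.finite_right (LinearMap.ker π)
  have := Module.Finite.of_surjective δ hδ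
  refine h2 _ fun w => ?_
  have hw : w ∘ₗ δ = 0 := h1 _ _ i hi <| by
    rw [map_zero]
    refine LinearMap.ext fun ψ => ?_
    change w (δ (ψ ∘ₗ i)) = 0
    rw [(hδ' _).2 ⟨ψ, rfl⟩, map_zero]
  refine LinearMap.ext fun x => ?_
  obtain ⟨x, rfl⟩ := hδ x
  exact LinearMap.congr_fun hw x

/-- A finitely generated `S`-module with zero dual is of the form `Ext¹_R(X, U)`. -/
lemma exists_equiv_extU [IsNoetherianRing S] (hU : IsDualizing R S U) (Y : Type u)
    [AddCommGroup Y] [Module S Y] [Module.Finite S Y] (hY : ∀ g : Y →ₗ[S] U, g = 0) :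
    ∃ (X : Type u) (_ : AddCommGroup X) (_ : Module R X) (_ : Module.Finite R X),
      Nonempty (Y ≃ₗ[S] ExtU R U X 1) := by
  have := hU.finite_left
  obtain ⟨m, π, hπ⟩ := Module.Finite.exists_fin' S Y
  obtain ⟨k, ρ, hρ⟩ := exists_free_range_eq (LinearMap.ker π)
  -- Dualizing the presentation `S^k → S^m → Y` gives `D`, whose kernel is `Y* = 0`. The module
  -- sought is its cokernel: as `Ext¹(U^k, U) = 0`, dualizing back recovers `Y`.
  let D : (Fin m → U) →ₗ[R] (Fin k → U) :=
    LinearMap.pi fun j => ∑ i, ρ (Pi.single j 1) i • LinearMap.proj i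
  have hD : ∀ y j, D y j = ∑ i, ρ (Pi.single j 1) i • y i := fun y j => by simp [D]
  have hsum : ∀ (t : Fin k → S) y, ∑ j, t j • D y j = ∑ i, ρ t i • y i := fun t y => by
    simp only [hD, Finset.smul_sum]
    rw [Finset.sum_comm]
    refine Finset.sum_congr rfl fun i _ => ?_
    rw [eq_sum_single ρ t, Finset.sum_apply, Finset.sum_smul]
    simp [mul_smul]
  have hDinj : Function.Injective D := by
    rw [injective_iff_map_eq_zero]
    intro y hy
    let G : (Fin m → S) →ₗ[S] U := ∑ i, LinearMap.toSpanSingleton S U (y i) ∘ₗ LinearMap.proj i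
    have hG : ∀ s, G s = ∑ i, s i • y i := fun s => by simp [G]
    obtain ⟨g, hg⟩ := exists_factor_of_surjective hπ G <| by
      intro s hs
      obtain ⟨t, rfl⟩ : s ∈ LinearMap.range ρ := hρ.ge hs
      rw [hG, ← hsum, hy]
      simp
    funext i
    have := hg (Pi.single i 1)
    rw [hY g, hG] at this
    simpa [Pi.single_apply, ite_smul] using this.symm
  obtain ⟨δ, hδ, hδ'⟩ := exists_connecting_map (U := U) S (ext_pow_subsingleton hU.ext_left k)
    hDinj (LinearMap.exact_map_mkQ_range D) (LinearMap.range D).mkQ_surjective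
  obtain ⟨τ, hτ⟩ := exists_pow_equiv_dual_pow (R := R) hU.bijective_right m
  refine ⟨(Fin k → U) ⧸ LinearMap.range D, inferInstance, inferInstance, inferInstance, ⟨?_⟩⟩
  have hker : LinearMap.ker (δ ∘ₗ τ.toLinearMap) = LinearMap.ker π := by
    ext s
    rw [LinearMap.mem_ker, LinearMap.comp_apply, LinearEquiv.coe_coe, hδ', ← hρ]
    constructor
    · rintro ⟨ψ, hψ⟩
      obtain ⟨t, ht⟩ := exists_scalars hU.bijective_right.2 ψ
      refine ⟨t, τ.injective (LinearMap.ext fun y => ?_)⟩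
      rw [← hψ, LinearMap.comp_apply, ht, hsum, hτ]
    · rintro ⟨t, rfl⟩
      refine ⟨∑ j, t j • LinearMap.proj j, LinearMap.ext fun y => ?_⟩
      rw [hτ, ← hsum]
      simp
  exact (π.quotKerEquivOfSurjective hπ).symm ≪≫ₗ Submodule.quotEquivOfEq _ _ hker.symm ≪≫ₗ
    (δ ∘ₗ τ.toLinearMap).quotKerEquivOfSurjective (hδ.comp τ.surjective)

lemma extVanishesOfDualZero_of_extExtVanishes [IsNoetherianRing S]
    (hU : IsDualizing R S U) (h : ExtExtVanishes R S U) : ExtVanishesOfDualZero S U := by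
  intro Y _ _ _ hY
  obtain ⟨X, _, _, _, ⟨e⟩⟩ := exists_equiv_extU (R := R) hU Y hY
  have := h X
  refine subsingleton_of_forall_eq 0 fun x => ?_
  have h1 : e.toModuleIso.hom ≫ e.toModuleIso.inv = 𝟙 (ModuleCat.of S Y) :=
    e.toModuleIso.hom_inv_id
  rw [← Abelian.Ext.mk₀_id_comp x, ← h1, ← Abelian.Ext.mk₀_comp_mk₀_assoc,
    this.elim ((Abelian.Ext.mk₀ e.toModuleIso.inv).comp x _) 0, Abelian.Ext.comp_zero]

end LeftExact

/-! ### A Wakamatsu tilting module is symmetric in the two rings -/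

section Wakamatsu

variable {R S : Type u} [Ring R] [Ring S] {U : Type u} [AddCommGroup U] [Module R U] [Module S U]
  [SMulCommClass R S U] [SMulCommClass S R U]

lemma InAdd.exists_eval (h : Function.Surjective (Module.toModuleEnd R (S := S) U))
    {T : Type u} [AddCommGroup T] [Module R T] (hT : InAdd R U T)
    (G : (T →ₗ[R] U) →ₗ[S] U) : ∃ y, ∀ k, G k = k y := by
  obtain ⟨n, s, r, hrs⟩ := hT
  obtain ⟨y, hy⟩ := exists_eval_pow h (G ∘ₗ LinearMap.lcomp S U s)
  refine ⟨r y, fun k => ?_⟩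
  have := hy (k ∘ₗ r)
  change G ((k ∘ₗ r) ∘ₗ s) = k (r y) at this
  rwa [LinearMap.comp_assoc, hrs, LinearMap.comp_id] at this

lemma InAdd.eq_zero {T : Type u} [AddCommGroup T] [Module R T] (hT : InAdd R U T) {x : T}
    (hx : ∀ k : T →ₗ[R] U, k x = 0) : x = 0 := by
  obtain ⟨n, s, r, hrs⟩ := hT
  have h : s x = 0 := funext fun i => hx (LinearMap.proj i ∘ₗ s)
  rw [← LinearMap.id_apply (R := R) x, ← hrs, LinearMap.comp_apply, h, map_zero]

/-- The dual of a module in `add U` is a summand of a finitely generated free module. -/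
lemma InAdd.exists_dual_summand (h : Function.Bijective (Module.toModuleEnd R (S := S) U))
    {T : Type u} [AddCommGroup T] [Module R T] (hT : InAdd R U T) :
    ∃ n, IsSummand S (T →ₗ[R] U) (Fin n → S) := by
  obtain ⟨n, s, r, hrs⟩ := hT
  obtain ⟨τ, -⟩ := exists_pow_equiv_dual_pow (R := R) h n
  refine ⟨n, τ.symm.toLinearMap ∘ₗ LinearMap.lcomp S U r, LinearMap.lcomp S U s ∘ₗ τ.toLinearMap,
    LinearMap.ext fun k => ?_⟩
  simp only [LinearMap.comp_apply, LinearEquiv.coe_coe, LinearEquiv.apply_symm_apply]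
  change (k ∘ₗ r) ∘ₗ s = k
  rw [LinearMap.comp_assoc, hrs, LinearMap.comp_id]

attribute [local instance] AddCoresolution.addCommGroup AddCoresolution.module

/-- Dualizing `0 → R → T₀ → T₁` presents `U ≅ R*` over S by `T₁* → T₀*`, with `T₀*` finitely
generated projective. Modules in `add U` are reflexive, so S-linear maps from `Tᵢ*` to `U` are
evaluations at points; exactness of the original sequence then locates these points. -/
lemma IsWakamatsuTilting.isDualizing (hU : IsWakamatsuTilting R U)
    (h : Function.Bijective (Module.toModuleEnd R (S := S) U)) : IsDualizing R S U := by
  obtain ⟨c⟩ := hU.coresolution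
  let w := c.aug 1
  have haug : ∀ r, c.aug r = r • w := fun r => by rw [← map_smul, smul_eq_mul, mul_one]
  let ev : (c.term 0 →ₗ[R] U) →ₗ[S] U := ⟨⟨fun g => g w, fun _ _ => rfl⟩, fun _ _ => rfl⟩
  have hev : Function.Surjective ev := fun u => by
    obtain ⟨g, hg⟩ := c.hom_surjective (LinearMap.toSpanSingleton R U u)
    refine ⟨g, (LinearMap.congr_fun hg 1).trans ?_⟩
    simp
  have hdw : c.d 0 w = 0 := c.exact_zero.apply_apply_eq_zero 1
  obtain ⟨n, i, p, hpi⟩ := (c.inAdd_term 0).exists_dual_summand h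
  refine ⟨hU.finite, ?_, ⟨?_, fun θ => ?_⟩, h, hU.selfOrthogonal 1 le_rfl, ?_⟩
  · have hp : Function.Surjective p := fun g => ⟨i g, LinearMap.congr_fun hpi g⟩
    exact Module.Finite.of_surjective (ev ∘ₗ p) (hev.comp hp)
  · rw [injective_iff_map_eq_zero]
    intro r hr
    have h0 : r • w = 0 := (c.inAdd_term 0).eq_zero fun k => by
      rw [map_smul]
      exact LinearMap.congr_fun hr (k w)
    exact (injective_iff_map_eq_zero _).1 c.injective_aug r (by rw [haug, h0])
  · obtain ⟨x, hx⟩ := (c.inAdd_term 0).exists_eval h.2 (θ ∘ₗ ev)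
    have hdx : c.d 0 x = 0 := (c.inAdd_term 1).eq_zero fun k => by
      have : θ ((k ∘ₗ c.d 0) w) = (k ∘ₗ c.d 0) x := hx (k ∘ₗ c.d 0)
      rw [LinearMap.comp_apply, hdw, map_zero, map_zero] at this
      exact this.symm
    obtain ⟨r, rfl⟩ := (c.exact_zero x).1 hdx
    refine ⟨r, LinearMap.ext fun u => ?_⟩
    obtain ⟨g, rfl⟩ := hev u
    have : θ (ev g) = g (c.aug r) := hx g
    rw [this, haug, map_smul]
    rfl
  · have hproj : Module.Projective S (c.term 0 →ₗ[R] U) := Module.Projective.of_split i p hpi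
    refine ext_subsingleton_of_extension (LinearMap.ker ev).injective_subtype
      (LinearMap.exact_subtype_ker_map ev) hev fun f => ?_
    let d' : (c.term 1 →ₗ[R] U) →ₗ[S] LinearMap.ker ev :=
      (LinearMap.lcomp S U (c.d 0)).codRestrict _ fun k => by
        change k (c.d 0 w) = 0
        rw [hdw, map_zero]
    -- A map on `ker ev` pulls back to evaluation at some `y` in `T₁`. Exactness puts `y` in the
    -- image of `T₀`, and evaluation at a preimage is the extension sought.
    obtain ⟨y, hy⟩ := (c.inAdd_term 1).exists_eval h.2 (f ∘ₗ d')
    have hdy : c.d 1 y = 0 := (c.inAdd_term 2).eq_zero fun k => by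
      have h1 := hy (k ∘ₗ c.d 1)
      have h2 : d' (k ∘ₗ c.d 1) = 0 := Subtype.ext <| by
        change (k ∘ₗ c.d 1) ∘ₗ c.d 0 = 0
        rw [LinearMap.comp_assoc, (c.exact_succ 0).linearMap_comp_eq_zero, LinearMap.comp_zero]
      rw [LinearMap.comp_apply, h2, map_zero] at h1
      exact h1.symm
    obtain ⟨x, rfl⟩ := (c.exact_succ 0 y).1 hdy
    refine ⟨⟨⟨fun g => g x, fun _ _ => rfl⟩, fun _ _ => rfl⟩, LinearMap.ext fun g => ?_⟩
    have hg : g.1 ∘ₗ c.aug = 0 := LinearMap.ext fun r => by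
      rw [LinearMap.comp_apply, haug, map_smul, show g.1 w = 0 from g.2, smul_zero]
      rfl
    obtain ⟨k, hk⟩ := (c.hom_exact_zero g.1).1 hg
    have : d' k = g := Subtype.ext hk
    rw [← this]
    exact (hy k).symm

end Wakamatsu

/-! ### Injective modules in `add-lim U` and rejects -/

section AddLim

variable {R : Type u} [Ring R]

/-- Over a left noetherian ring, maps from a finitely generated module to a directed limit factor
through a term. -/
lemma exists_factor_directLimit [IsNoetherianRing R] {I : Type u} [DecidableEq I] [Preorder I]
    [IsDirectedOrder I] [Nonempty I] {G : I → Type u} [∀ i, AddCommGroup (G i)]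
    [∀ i, Module R (G i)] (f : ∀ i j, i ≤ j → G i →ₗ[R] G j)
    [DirectedSystem G fun i j h => f i j h] {N : Type u} [AddCommGroup N] [Module R N]
    [Module.Finite R N] (φ : N →ₗ[R] Module.DirectLimit G f) :
    ∃ i, ∃ g : N →ₗ[R] G i, ∀ x, Module.DirectLimit.of R I G f i (g x) = φ x := by
  obtain ⟨m, π, hπ⟩ := Module.Finite.exists_fin' R N
  obtain ⟨k, ρ, hρ⟩ := exists_free_range_eq (LinearMap.ker π)
  choose a y hy using fun l : Fin m =>
    Module.DirectLimit.exists_of (φ (π (Pi.single l 1)))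
  obtain ⟨i, hi⟩ := Finite.exists_le a
  let ψ : (Fin m → R) →ₗ[R] G i :=
    ∑ l, LinearMap.toSpanSingleton R (G i) (f _ _ (hi l) (y l)) ∘ₗ LinearMap.proj l
  have hψ : ∀ p, Module.DirectLimit.of R I G f i (ψ p) = φ (π p) := fun p => by
    rw [eq_sum_single π p]
    simp [ψ, Module.DirectLimit.of_f, hy]
  have h0 : ∀ l : Fin k, Module.DirectLimit.of R I G f i (ψ (ρ (Pi.single l 1))) = 0 := fun l => by
    rw [hψ, show π (ρ (Pi.single l 1)) = 0 from hρ.le ⟨_, rfl⟩, map_zero]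
  choose b hb hb0 using fun l => Module.DirectLimit.of.zero_exact (h0 l)
  obtain ⟨j', hj'⟩ := Finite.exists_le b
  obtain ⟨j, hij, hj⟩ := exists_ge_ge i j'
  obtain ⟨g, hg⟩ := exists_factor_of_surjective hπ (f i j hij ∘ₗ ψ) <| by
    intro p hp
    obtain ⟨c, rfl⟩ : p ∈ LinearMap.range ρ := hρ.ge hp
    rw [← LinearMap.comp_apply, eq_sum_single _ c]
    refine Finset.sum_eq_zero fun l _ => ?_
    rw [LinearMap.comp_apply, LinearMap.comp_apply,
      ← Module.DirectedSystem.map_map f (hb l) ((hj' l).trans hj), hb0, map_zero, smul_zero]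
  refine ⟨j, g, fun x => ?_⟩
  obtain ⟨p, rfl⟩ := hπ x
  rw [hg, LinearMap.comp_apply, Module.DirectLimit.of_f, hψ]

variable {U : Type u} [AddCommGroup U] [Module R U]

/-- Maps from finitely generated modules to a module in `add-lim U` vanish on the reject of `U`. -/
lemma InAddLim.apply_eq_zero [IsNoetherianRing R] {E : Type u} [AddCommGroup E] [Module R E]
    (hE : InAddLim R U E) {N : Type u} [AddCommGroup N] [Module R N] [Module.Finite R N]
    (φ : N →ₗ[R] E) {x : N} (hx : x ∈ reject R U N) : φ x = 0 := by
  obtain ⟨I, _, _, _, n, f, _, s, r, hrs⟩ := hE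
  classical
  obtain ⟨i, g, hg⟩ := exists_factor_directLimit f (s ∘ₗ φ)
  have h0 : g x = 0 := funext fun l => mem_reject.1 hx (LinearMap.proj l ∘ₗ g)
  have h1 : s (φ x) = 0 := by rw [← LinearMap.comp_apply, ← hg, h0, map_zero]
  rw [← LinearMap.id_apply (R := R) (φ x), ← hrs, LinearMap.comp_apply, h1, map_zero]

variable (R U) in
/-- The category of finite powers of `U` over `E`. -/
structure PowOver (E : Type u) [AddCommGroup E] [Module R E] where
  exponent : ℕ
  hom : (Fin exponent → U) →ₗ[R] E

instance PowOver.category (E : Type u) [AddCommGroup E] [Module R E] :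
    SmallCategory (PowOver R U E) where
  Hom X Y := { a : (Fin X.exponent → U) →ₗ[R] (Fin Y.exponent → U) // Y.hom ∘ₗ a = X.hom }
  id X := ⟨LinearMap.id, LinearMap.comp_id _⟩
  comp a b := ⟨b.1 ∘ₗ a.1, by rw [← LinearMap.comp_assoc, b.2, a.2]⟩

variable {S : Type u} [Ring S] [Module S U] [SMulCommClass R S U] [SMulCommClass S R U]

/-- If maps from finitely generated modules to the injective module `E` vanish on rejects of `U`,
then they factor through finite powers of `U`. -/
lemma exists_factor_pow [IsNoetherianRing S] (hU : IsDualizing R S U) {E : Type u} [AddCommGroup E]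
    [Module R E] [Module.Injective R E]
    (H : ∀ (N : Type u) [AddCommGroup N] [Module R N] [Module.Finite R N] (φ : N →ₗ[R] E),
      ∀ x ∈ reject R U N, φ x = 0)
    {N : Type u} [AddCommGroup N] [Module R N] [Module.Finite R N] (φ : N →ₗ[R] E) :
    ∃ (p : ℕ) (c : N →ₗ[R] (Fin p → U)) (ψ : (Fin p → U) →ₗ[R] E), ψ ∘ₗ c = φ := by
  have := finite_dual (R := R) hU.finite_right N
  obtain ⟨p, q, hq⟩ := Module.Finite.exists_fin' S (N →ₗ[R] U)
  -- Since the coordinates of `c` generate `N*` over S, its kernel lies in the reject, which `φ`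
  -- kills.
  let c : N →ₗ[R] (Fin p → U) := LinearMap.pi fun i => q (Pi.single i 1)
  obtain ⟨g, hg⟩ := exists_factor_of_surjective c.surjective_rangeRestrict φ <| by
    intro x hx
    have hx' : c x = 0 := congrArg Subtype.val hx
    refine H N φ x (mem_reject.2 fun k => ?_)
    obtain ⟨s, rfl⟩ := hq k
    rw [eq_sum_single q s, LinearMap.sum_apply]
    refine Finset.sum_eq_zero fun i _ => ?_
    rw [LinearMap.smul_apply, show q (Pi.single i 1) x = 0 from congrFun hx' i, smul_zero]
  obtain ⟨ψ, hψ⟩ := Module.Injective.out (LinearMap.range c).subtype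
    (LinearMap.range c).injective_subtype g
  exact ⟨p, c, ψ, LinearMap.ext fun x => (hψ _).trans (hg x)⟩

/-- Factoring through powers of `U` makes the category of powers over `E` filtered. A directed set
with a final functor to it gives a direct limit that maps isomorphically onto `E`. -/
lemma inAddLim_of_apply_eq_zero [IsNoetherianRing S] (hU : IsDualizing R S U) {E : Type u}
    [AddCommGroup E] [Module R E] [Module.Injective R E]
    (H : ∀ (N : Type u) [AddCommGroup N] [Module R N] [Module.Finite R N] (φ : N →ₗ[R] E),
      ∀ x ∈ reject R U N, φ x = 0) : InAddLim R U E := by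
  have := hU.finite_left
  have hker : ∀ (X : PowOver R U E) (y : Fin X.exponent → U), X.hom y = 0 →
      ∃ (Y : PowOver R U E) (b : X ⟶ Y), b.1 y = 0 := fun X y hy => by
    let K := Submodule.span R {y}
    obtain ⟨p, c, ψ, hψ⟩ := exists_factor_pow hU H
      (K.liftQ X.hom (Submodule.span_le.2 (by simpa using hy)))
    refine ⟨⟨p, ψ⟩, ⟨c ∘ₗ K.mkQ, ?_⟩, ?_⟩
    · rw [← LinearMap.comp_assoc, hψ, K.liftQ_mkQ]
    · rw [LinearMap.comp_apply, K.mkQ_apply,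
        (Submodule.Quotient.mk_eq_zero K).2 (Submodule.mem_span_singleton_self y), map_zero]
  have hfilt : IsFiltered (PowOver R U E) :=
    { nonempty := ⟨⟨0, 0⟩⟩
      cocone_objs := fun X Y => by
        obtain ⟨p, c, ψ, hψ⟩ := exists_factor_pow hU H (X.hom.coprod Y.hom)
        refine ⟨⟨p, ψ⟩, ⟨c ∘ₗ LinearMap.inl R _ _, ?_⟩, ⟨c ∘ₗ LinearMap.inr R _ _, ?_⟩, trivial⟩
        · rw [← LinearMap.comp_assoc, hψ, LinearMap.coprod_inl]
        · rw [← LinearMap.comp_assoc, hψ, LinearMap.coprod_inr]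
      cocone_maps := fun X Y a b => by
        let K := LinearMap.range (a.1 - b.1)
        obtain ⟨p, c, ψ, hψ⟩ := exists_factor_pow hU H (K.liftQ Y.hom (by
          rintro _ ⟨x, rfl⟩
          have := LinearMap.congr_fun (a.2.trans b.2.symm) x
          rw [LinearMap.mem_ker, LinearMap.sub_apply, map_sub, sub_eq_zero]
          exact this))
        refine ⟨⟨p, ψ⟩, ⟨c ∘ₗ K.mkQ, ?_⟩, Subtype.ext (LinearMap.ext fun x => ?_)⟩
        · rw [← LinearMap.comp_assoc, hψ, K.liftQ_mkQ]
        · change c (K.mkQ (a.1 x)) = c (K.mkQ (b.1 x))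
          congr 1
          exact (Submodule.Quotient.eq K).2 ⟨x, rfl⟩ }
  obtain ⟨α, _, _, _, F, hF⟩ := IsFiltered.exists_directed (PowOver R U E)
  have hα : IsFiltered α := isFiltered_of_directed_le_nonempty α
  rw [Functor.final_iff_of_isFiltered] at hF
  let f : ∀ i j : α, i ≤ j →
      (Fin (F.obj i).exponent → U) →ₗ[R] (Fin (F.obj j).exponent → U) :=
    fun i j h => (F.map (homOfLE h)).1
  have hdir : DirectedSystem (fun i => Fin (F.obj i).exponent → U) fun i j h => f i j h :=
    { map_self := fun i x => by
        change (F.map (𝟙 i)).1 x = x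
        rw [F.map_id]
        rfl
      map_map := fun k j i hij hjk x => by
        change (F.map (homOfLE hij) ≫ F.map (homOfLE hjk)).1 x = _
        rw [← F.map_comp]
        rfl }
  refine ⟨α, inferInstance, inferInstance, inferInstance, fun i => (F.obj i).exponent, f, hdir, ?_⟩
  classical
  let L := Module.DirectLimit.lift R α (fun i => Fin (F.obj i).exponent → U) f
    (fun i => (F.obj i).hom) fun i j h x => LinearMap.congr_fun (F.map (homOfLE h)).2 x
  have hL_inj : Function.Injective L := by
    rw [injective_iff_map_eq_zero]
    intro z hz
    obtain ⟨i, y, rfl⟩ := Module.DirectLimit.exists_of z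
    rw [Module.DirectLimit.lift_of] at hz
    obtain ⟨Y, b, hb⟩ := hker _ y hz
    obtain ⟨k, ⟨t⟩⟩ := hF.1 Y
    obtain ⟨l, hil, hkl⟩ := exists_ge_ge i k
    obtain ⟨m, v, hv⟩ := hF.2 (F.map (homOfLE hil)) (b ≫ t ≫ F.map (homOfLE hkl))
    rw [← Module.DirectLimit.of_f (hij := hil.trans (leOfHom v))]
    have h1 : f i m (hil.trans (leOfHom v)) y = (F.map (homOfLE hil) ≫ F.map v).1 y := by
      rw [← F.map_comp]
      rfl
    rw [h1, hv]
    change Module.DirectLimit.of R α (fun i => Fin (F.obj i).exponent → U) f m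
      ((F.map v).1 ((F.map (homOfLE hkl)).1 (t.1 (b.1 y)))) = 0
    rw [hb]
    simp only [map_zero]
  have hL_surj : Function.Surjective L := fun x => by
    have := hU.finite_right
    obtain ⟨n, q, hq⟩ := Module.Finite.exists_fin' S U
    -- `R` embeds in `U^n` by acting on S-generators of the faithful module `U`, so injectivity of
    -- `E` puts each `x` in the image of a power of `U`.
    let w : Fin n → U := fun i => q (Pi.single i 1)
    obtain ⟨φ, hφ⟩ := Module.Injective.out (LinearMap.toSpanSingleton R (Fin n → U) w)
      (by
        rw [injective_iff_map_eq_zero]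
        intro r hr
        refine eq_zero_of_forall_smul hU.bijective_left.1 fun u => ?_
        obtain ⟨s, rfl⟩ := hq u
        rw [eq_sum_single q s, Finset.smul_sum]
        refine Finset.sum_eq_zero fun i _ => ?_
        rw [smul_comm, show r • q (Pi.single i 1) = 0 from congrFun hr i, smul_zero])
      (LinearMap.toSpanSingleton R E x)
    obtain ⟨i, ⟨t⟩⟩ := hF.1 ⟨n, φ⟩
    refine ⟨Module.DirectLimit.of R α _ f i (t.1 w), ?_⟩
    rw [Module.DirectLimit.lift_of]
    have h1 : (F.obj i).hom (t.1 w) = φ w := LinearMap.congr_fun t.2 w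
    rw [h1]
    simpa using hφ 1
  let e := LinearEquiv.ofBijective L ⟨hL_inj, hL_surj⟩
  have key : IsSummand R E (Module.DirectLimit (fun i => Fin (F.obj i).exponent → U) f) :=
    ⟨e.symm.toLinearMap, e.toLinearMap, LinearMap.ext fun x => e.apply_symm_apply x⟩
  convert key

end AddLim

/-! ### Injective envelopes and minimal injective resolutions -/

section Envelope

variable (R : Type u) [Ring R]

/-- A submodule containing `N` that is maximal among the essential extensions of `N` inside an
injective module is injective. -/
lemma exists_essential_injective_submodule {I : Type u} [AddCommGroup I] [Module R I]
    [Module.Injective R I] (N : Submodule R I) :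
    ∃ X : Submodule R I, N ≤ X ∧ Module.Injective R X ∧
      ∀ x ∈ X, x ≠ 0 → ∃ r : R, r • x ∈ N ∧ r • x ≠ 0 := by
  obtain ⟨X, hNX, hX⟩ := zorn_le_nonempty₀
    {X : Submodule R I | ∀ x ∈ X, x ≠ 0 → ∃ r : R, r • x ∈ N ∧ r • x ≠ 0}
    (fun c hc hchain Y hY => by
      refine ⟨sSup c, fun x hx hx0 => ?_, fun Z hZ => le_sSup hZ⟩
      obtain ⟨Z, hZ, hxZ⟩ := (Submodule.mem_sSup_of_directed ⟨Y, hY⟩ hchain.directedOn).1 hx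
      exact hc hZ x hxZ hx0)
    N (fun x hx hx0 => ⟨1, by simpa using hx, by simpa using hx0⟩)
  -- `C` is a maximal submodule meeting `X` trivially, so `X` embeds in `I / C`. The extension `h`
  -- of its inclusion will have image inside `X`, making `X` a retract of `I`.
  obtain ⟨C, -, hC⟩ := zorn_le_nonempty₀ {C : Submodule R I | ∀ x ∈ C, x ∈ X → x = 0}
    (fun c hc hchain Y hY => by
      refine ⟨sSup c, fun x hx hxX => ?_, fun Z hZ => le_sSup hZ⟩
      obtain ⟨Z, hZ, hxZ⟩ := (Submodule.mem_sSup_of_directed ⟨Y, hY⟩ hchain.directedOn).1 hx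
      exact hc hZ x hxZ hxX)
    ⊥ (fun x hx _ => by simpa using hx)
  obtain ⟨h, hh⟩ := Module.Injective.out (C.mkQ ∘ₗ X.subtype)
    (by
      rw [injective_iff_map_eq_zero]
      intro x hx
      exact Subtype.ext (hC.prop x ((Submodule.Quotient.mk_eq_zero C).1 hx) x.2)) X.subtype
  have hh' : ∀ x ∈ X, h (C.mkQ x) = x := fun x hx => hh ⟨x, hx⟩
  have hrange : LinearMap.range (h ∘ₗ C.mkQ) ≤ X := by
    -- The image is again essential over `N`: for `z` outside `C`, maximality of `C` gives a nonzero
    -- `c + r • z` in `X`, and it equals `r • h z`.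
    refine hX.le_of_ge ?_ fun x hx => ⟨x, hh' x hx⟩
    rintro _ ⟨z, rfl⟩ hz
    have hzC : z ∉ C := fun hzC => hz <| by
      rw [LinearMap.comp_apply, C.mkQ_apply, (Submodule.Quotient.mk_eq_zero C).2 hzC, map_zero]
    have : ¬ ∀ x ∈ C ⊔ Submodule.span R {z}, x ∈ X → x = 0 := fun hall =>
      hzC (hC.le_of_ge hall le_sup_left
        (Submodule.mem_sup_right (Submodule.mem_span_singleton_self z)))
    push Not at this
    obtain ⟨x, hx, hxX, hx0⟩ := this
    obtain ⟨c, hc, y, hy, rfl⟩ := Submodule.mem_sup.1 hx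
    obtain ⟨r, rfl⟩ := Submodule.mem_span_singleton.1 hy
    obtain ⟨r', hr', hr0⟩ := hX.prop _ hxX hx0
    have hc0 : C.mkQ c = 0 := (Submodule.Quotient.mk_eq_zero C).2 hc
    have h1 : r • h (C.mkQ z) = c + r • z := by
      rw [← hh' _ hxX, map_add C.mkQ, hc0, zero_add, map_smul, map_smul]
    refine ⟨r' * r, ?_⟩
    rw [LinearMap.comp_apply, mul_smul, h1]
    exact ⟨hr', hr0⟩
  refine ⟨X, hNX, ⟨fun A B _ _ _ _ f hf g => ?_⟩, hX.prop⟩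
  obtain ⟨k, hk⟩ := Module.Injective.out f hf (X.subtype ∘ₗ g)
  refine ⟨(h ∘ₗ C.mkQ).codRestrict X (fun z => hrange ⟨z, rfl⟩) ∘ₗ k, fun a => Subtype.ext ?_⟩
  change h (C.mkQ (k (f a))) = g a
  rw [hk]
  exact hh' _ (g a).2

/-- Injective envelopes exist. -/
lemma exists_injective_envelope (M : ModuleCat.{u} R) :
    ∃ (E : ModuleCat.{u} R) (i : M →ₗ[R] E), Function.Injective i ∧ Module.Injective R E ∧
      IsEssential R (LinearMap.range i) := by
  let I := Injective.under M
  let ι : M →ₗ[R] I := (Injective.ι M).hom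
  have hι : Function.Injective ι := (ModuleCat.mono_iff_injective (Injective.ι M)).1 inferInstance
  have hI : Injective (ModuleCat.of R I) := inferInstanceAs (Injective (Injective.under M))
  have : Module.Injective R I := Module.injective_module_of_injective_object R I
  obtain ⟨X, hNX, hX, hess⟩ := exists_essential_injective_submodule R (LinearMap.range ι)
  refine ⟨ModuleCat.of R X, ι.codRestrict X fun x => hNX ⟨x, rfl⟩, fun x y hxy =>
    hι (congrArg Subtype.val hxy), hX, fun K hK => ?_⟩
  refine (Submodule.eq_bot_iff K).2 fun x hx => by_contra fun hx0 => ?_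
  obtain ⟨r, ⟨m, hm⟩, hr0⟩ := hess x.1 x.2 fun h => hx0 (Subtype.ext h)
  have : r • x ∈ K ⊓ LinearMap.range (ι.codRestrict X fun x => hNX ⟨x, rfl⟩) :=
    ⟨K.smul_mem r hx, m, Subtype.ext hm⟩
  rw [hK] at this
  exact hr0 (congrArg Subtype.val ((Submodule.mem_bot R).1 this))

/-- The injective envelope of a module. -/
noncomputable def envelope (M : ModuleCat.{u} R) : ModuleCat.{u} R :=
  (exists_injective_envelope R M).choose

/-- The inclusion of a module in its injective envelope. -/
noncomputable def envelopeMap (M : ModuleCat.{u} R) : M →ₗ[R] envelope R M :=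
  (exists_injective_envelope R M).choose_spec.choose

lemma envelopeMap_spec (M : ModuleCat.{u} R) : Function.Injective (envelopeMap R M) ∧
    Module.Injective R (envelope R M) ∧ IsEssential R (LinearMap.range (envelopeMap R M)) :=
  (exists_injective_envelope R M).choose_spec.choose_spec

/-- The cosyzygies of a module in its minimal injective resolution. -/
noncomputable def cosyzygy (M : ModuleCat.{u} R) : ℕ → ModuleCat.{u} R
  | 0 => M
  | n + 1 => ModuleCat.of R
      (envelope R (cosyzygy M n) ⧸ LinearMap.range (envelopeMap R (cosyzygy M n)))

/-- The projection onto the next cosyzygy. -/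
noncomputable def toCosyzygy (M : ModuleCat.{u} R) (n : ℕ) :
    envelope R (cosyzygy R M n) →ₗ[R] cosyzygy R M (n + 1) :=
  (LinearMap.range (envelopeMap R (cosyzygy R M n))).mkQ

lemma toCosyzygy_surjective (M : ModuleCat.{u} R) (n : ℕ) :
    Function.Surjective (toCosyzygy R M n) :=
  (LinearMap.range (envelopeMap R (cosyzygy R M n))).mkQ_surjective

lemma exact_toCosyzygy (M : ModuleCat.{u} R) (n : ℕ) :
    Function.Exact (envelopeMap R (cosyzygy R M n))
      (envelopeMap R (cosyzygy R M (n + 1)) ∘ₗ toCosyzygy R M n) := by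
  intro x
  rw [LinearMap.comp_apply, map_eq_zero_iff _ (envelopeMap_spec R _).1]
  exact LinearMap.exact_map_mkQ_range (envelopeMap R (cosyzygy R M n)) x

lemma range_envelopeMap_comp (M : ModuleCat.{u} R) (n : ℕ) :
    LinearMap.range (envelopeMap R (cosyzygy R M (n + 1)) ∘ₗ toCosyzygy R M n) =
      LinearMap.range (envelopeMap R (cosyzygy R M (n + 1))) :=
  LinearMap.range_comp_of_range_eq_top _ (LinearMap.range_eq_top.2 (toCosyzygy_surjective R M n))

/-- Every module has a minimal injective resolution. -/
noncomputable def minimalInjectiveResolution (M : Type u) [AddCommGroup M] [Module R M] :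
    MinimalInjectiveResolution R M where
  term n := envelope R (cosyzygy R (ModuleCat.of R M) n)
  aug := envelopeMap R (ModuleCat.of R M)
  d n := envelopeMap R (cosyzygy R (ModuleCat.of R M) (n + 1)) ∘ₗ toCosyzygy R (ModuleCat.of R M) n
  injective_term _ := (envelopeMap_spec R _).2.1
  injective_aug := (envelopeMap_spec R _).1
  exact_zero := exact_toCosyzygy R _ 0
  exact_succ n := by
    rw [LinearMap.exact_iff, range_envelopeMap_comp, ← LinearMap.exact_iff]
    exact exact_toCosyzygy R _ (n + 1)
  essential_zero := (envelopeMap_spec R _).2.2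
  essential_succ n := by
    rw [range_envelopeMap_comp]
    exact (envelopeMap_spec R _).2.2

end Envelope

/-! ### Dominant dimension at least two through the two conditions -/

section DominantDimension

variable {R : Type u} [Ring R] {U : Type u} [AddCommGroup U] [Module R U]

/-- A map `X → U ⊆ E₀` extends to `N → E₀`, and that extension kills the reject. -/
lemma rejectDualVanishes_of_uDomDimGE [IsNoetherianRing R] (h : UDomDimGE R U U 2) :
    RejectDualVanishes R U := by
  obtain ⟨E, hE⟩ := h
  intro N _ _ _ X hX g
  have := E.injective_term 0
  obtain ⟨φ, hφ⟩ := Module.Injective.out X.subtype X.injective_subtype (E.aug ∘ₗ g)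
  refine LinearMap.ext fun x => E.injective_aug ?_
  rw [LinearMap.zero_apply, map_zero, ← LinearMap.comp_apply, ← hφ]
  exact (hE 0 two_pos).apply_eq_zero φ (hX x.2)

/-- Extend `φ` to a map from the free cover to `E₀`. It induces `X → E₁`, which is zero because `X`
is its own reject; hence the extension already lands in `U`. -/
lemma extVanishesOfDualZero_of_uDomDimGE [IsNoetherianRing R] (h : UDomDimGE R U U 2) :
    ExtVanishesOfDualZero R U := by
  obtain ⟨E, hE⟩ := h
  intro X _ _ _ hX
  obtain ⟨m, π, hπ⟩ := Module.Finite.exists_fin' R X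
  let i := (LinearMap.ker π).subtype
  have hi : Function.Injective i := (LinearMap.ker π).injective_subtype
  refine ext_subsingleton_of_extension hi (LinearMap.exact_subtype_ker_map π) hπ fun φ => ?_
  have := E.injective_term 0
  obtain ⟨ψ, hψ⟩ := Module.Injective.out i hi (E.aug ∘ₗ φ)
  obtain ⟨g, hg⟩ := exists_factor_of_surjective hπ (E.d 0 ∘ₗ ψ) fun p hp => by
    rw [LinearMap.comp_apply, show ψ p = E.aug (φ ⟨p, hp⟩) from hψ ⟨p, hp⟩]
    exact E.exact_zero.apply_apply_eq_zero _
  obtain ⟨χ, hχ⟩ := exists_factor_of_injective E.injective_aug ψ fun p => (E.exact_zero _).1 <| by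
    rw [← LinearMap.comp_apply, ← hg]
    refine (hE 1 one_lt_two).apply_eq_zero g (mem_reject.2 fun f => ?_)
    rw [hX f, LinearMap.zero_apply]
  refine ⟨χ, LinearMap.ext fun p => E.injective_aug ?_⟩
  rw [LinearMap.comp_apply, hχ, hψ, LinearMap.comp_apply]

/-- A linear map vanishes on a submodule if it vanishes on the part mapped to an essential
submodule. -/
lemma apply_eq_zero_of_isEssential {E N : Type u} [AddCommGroup E] [Module R E] [AddCommGroup N]
    [Module R N] {L : Submodule R E} (hL : IsEssential R L) (φ : N →ₗ[R] E) (T : Submodule R N)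
    (h : ∀ x ∈ T, φ x ∈ L → φ x = 0) {x : N} (hx : x ∈ T) : φ x = 0 := by
  have : T.map φ = ⊥ := hL _ <| (Submodule.eq_bot_iff _).2 <| by
    rintro _ ⟨⟨y, hy, rfl⟩, hyL⟩
    exact h y hy hyL
  exact (Submodule.mem_bot R).1 (this ▸ Submodule.mem_map_of_mem hx)

/-- By essentiality only the part `X` of the reject mapped into `U`, respectively into the image of
`E₀`, matters. In the first case `X* = 0` suffices; in the second, `Ext¹(X, U) = 0` lifts `X → E₁`
to `E₀`, where the first case applies. -/
lemma uDomDimGE_two_of_vanishing {S : Type u} [Ring S] [Module S U] [SMulCommClass R S U]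
    [SMulCommClass S R U] [IsNoetherianRing R] [IsNoetherianRing S] (hU : IsDualizing R S U)
    (h1 : RejectDualVanishes R U) (h2 : ExtVanishesOfDualZero R U) : UDomDimGE R U U 2 := by
  let E := minimalInjectiveResolution R U
  have hinj := E.injective_term
  have hE0 : ∀ (N : Type u) [AddCommGroup N] [Module R N] [Module.Finite R N]
      (φ : N →ₗ[R] E.term 0), ∀ x ∈ reject R U N, φ x = 0 := by
    intro N _ _ _ φ x hx
    refine apply_eq_zero_of_isEssential E.essential_zero φ _ (fun y hy hyL => ?_) hx
    let X := reject R U N ⊓ (LinearMap.range E.aug).comap φ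
    obtain ⟨g, hg⟩ := exists_factor_of_injective E.injective_aug (φ ∘ₗ X.subtype) fun z => z.2.2
    have := hg ⟨y, hy, hyL⟩
    rw [h1 N X inf_le_left g, LinearMap.zero_apply, map_zero] at this
    exact this.symm
  have hE1 : ∀ (N : Type u) [AddCommGroup N] [Module R N] [Module.Finite R N]
      (φ : N →ₗ[R] E.term 1), ∀ x ∈ reject R U N, φ x = 0 := by
    intro N _ _ _ φ x hx
    refine apply_eq_zero_of_isEssential (E.essential_succ 0) φ _ (fun y hy hyL => ?_) hx
    let X := reject R U N ⊓ (LinearMap.range (E.d 0)).comap φ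
    obtain ⟨m, π, hπ⟩ := Module.Finite.exists_fin' R X
    choose e he using fun l : Fin m => (π (Pi.single l 1)).2.2
    let L : (Fin m → R) →ₗ[R] E.term 0 :=
      ∑ l, LinearMap.toSpanSingleton R _ (e l) ∘ₗ LinearMap.proj l
    have hL : ∀ p, E.d 0 (L p) = φ (π p) := fun p => by
      rw [eq_sum_single π p]
      simp [L, he]
    obtain ⟨k, hk⟩ := exists_factor_of_injective E.injective_aug (L ∘ₗ (LinearMap.ker π).subtype)
      fun p => (E.exact_zero _).1 <| by
        rw [LinearMap.comp_apply, hL, Submodule.subtype_apply, show π p.1 = 0 from p.2]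
        simp
    obtain ⟨ψ, hψ⟩ := exists_extension_of_ext_subsingleton
      (h2 X (h1 N X inf_le_left)) (LinearMap.ker π).injective_subtype
      (LinearMap.exact_subtype_ker_map π) hπ k
    -- `L` lifts `φ ∘ π` to `E₀`; subtracting `ψ`, which agrees with it on `ker π`, makes it descend
    -- to `X`.
    obtain ⟨g, hg⟩ := exists_factor_of_surjective hπ (L - E.aug ∘ₗ ψ) fun p hp => by
      rw [LinearMap.sub_apply, sub_eq_zero, LinearMap.comp_apply]
      exact (hk ⟨p, hp⟩).symm.trans (congrArg E.aug (LinearMap.congr_fun hψ ⟨p, hp⟩).symm)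
    have hdg : ∀ z : X, E.d 0 (g z) = φ z := fun z => by
      obtain ⟨p, rfl⟩ := hπ z
      rw [hg, LinearMap.sub_apply, map_sub, hL, LinearMap.comp_apply,
        E.exact_zero.apply_apply_eq_zero, sub_zero]
    obtain ⟨g', hg'⟩ := Module.Injective.out X.subtype X.injective_subtype g
    have : g ⟨y, hy, hyL⟩ = 0 := (hg' _).symm.trans (hE0 N g' y hy)
    rw [← hdg ⟨y, hy, hyL⟩, this, map_zero]
  refine ⟨E, fun i hi => ?_⟩
  match i, hi with
  | 0, _ => exact inAddLim_of_apply_eq_zero hU hE0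
  | 1, _ => exact inAddLim_of_apply_eq_zero hU hE1

end DominantDimension

/-! ### Passing between the two sides -/

section Equivalence

variable {R S : Type u} [Ring R] [Ring S] {U : Type u} [AddCommGroup U] [Module R U] [Module S U]
  [SMulCommClass R S U] [SMulCommClass S R U] [IsNoetherianRing R] [IsNoetherianRing S]

lemma uDomDimGE_two_iff (hU : IsDualizing R S U) :
    UDomDimGE R U U 2 ↔ RejectDualVanishes R U ∧ ExtVanishesOfDualZero R U :=
  ⟨fun h => ⟨rejectDualVanishes_of_uDomDimGE h, extVanishesOfDualZero_of_uDomDimGE h⟩,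
    fun h => uDomDimGE_two_of_vanishing hU h.1 h.2⟩

lemma vanishing_of_leftExact (h : DoubleDualLeftExact R S U) :
    RejectDualVanishes R U ∧ ExtVanishesOfDualZero R U :=
  ⟨rejectDualVanishes_of_preservesMono (preservesMono_of_leftExact h),
    extVanishesOfDualZero_of_leftExact h⟩

lemma leftExact_iff_vanishing (hU : IsDualizing R S U) :
    DoubleDualLeftExact R S U ↔ RejectDualVanishes S U ∧ ExtVanishesOfDualZero S U :=
  ⟨fun h => vanishing_of_leftExact <|
      have h' := vanishing_of_leftExact h
      leftExact_of_extVanishesOfDualZero hU.symm h'.1 h'.2,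
    fun h => leftExact_of_extVanishesOfDualZero hU h.1 h.2⟩

lemma vanishing_comm (hU : IsDualizing R S U) :
    RejectDualVanishes R U ∧ ExtVanishesOfDualZero R U ↔
      RejectDualVanishes S U ∧ ExtVanishesOfDualZero S U :=
  ⟨fun h => vanishing_of_leftExact (leftExact_of_extVanishesOfDualZero hU.symm h.1 h.2),
    fun h => vanishing_of_leftExact (leftExact_of_extVanishesOfDualZero hU h.1 h.2)⟩

/-- Preservation of monomorphisms over R first gives the reject condition over R; passing through
preservation over S moves it to S. -/
lemma preservesMono_and_extExtVanishes_iff (hU : IsDualizing R S U) :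
    DoubleDualPreservesMono R S U ∧ ExtExtVanishes R S U ↔
      RejectDualVanishes S U ∧ ExtVanishesOfDualZero S U := by
  refine ⟨fun h => ⟨?_, extVanishesOfDualZero_of_extExtVanishes hU h.2⟩, fun h => ?_⟩
  · exact rejectDualVanishes_of_preservesMono (preservesMono_of_rejectDualVanishes hU.symm
      (rejectDualVanishes_of_preservesMono h.1))
  · have hmono := preservesMono_of_rejectDualVanishes hU h.1
    exact ⟨hmono, extExtVanishes_of_extVanishesOfDualZero hU hmono h.2⟩

end Equivalence

end WakamatsuDom

theorem proposition4p4
    (Λ Γ : Type u) [Ring Λ] [Ring Γ]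
    [IsNoetherianRing Λ] [IsNoetherianRing Λᵐᵒᵖ] [IsNoetherianRing Γ] [IsNoetherianRing Γᵐᵒᵖ]
    (U : Type u) [AddCommGroup U] [Module Λ U] [Module Γᵐᵒᵖ U]
    [SMulCommClass Λ Γᵐᵒᵖ U] [SMulCommClass Γᵐᵒᵖ Λ U]
    (hU : WakamatsuDom.IsWakamatsuTilting Λ U)
    (hΓ : Function.Bijective (Module.toModuleEnd Λ (S := Γᵐᵒᵖ) U)) :
    [ WakamatsuDom.UDomDimGE Λ U U 2,
      WakamatsuDom.DoubleDualLeftExact Λ Γᵐᵒᵖ U,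
      WakamatsuDom.DoubleDualPreservesMono Λ Γᵐᵒᵖ U ∧ WakamatsuDom.ExtExtVanishes Λ Γᵐᵒᵖ U,
      WakamatsuDom.UDomDimGE Γᵐᵒᵖ U U 2,
      WakamatsuDom.DoubleDualLeftExact Γᵐᵒᵖ Λ U,
      WakamatsuDom.DoubleDualPreservesMono Γᵐᵒᵖ Λ U ∧
        WakamatsuDom.ExtExtVanishes Γᵐᵒᵖ Λ U ].TFAE := by
  have h := hU.isDualizing hΓ
  rw [WakamatsuDom.uDomDimGE_two_iff h, WakamatsuDom.leftExact_iff_vanishing h,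
    WakamatsuDom.preservesMono_and_extExtVanishes_iff h, WakamatsuDom.uDomDimGE_two_iff h.symm,
    WakamatsuDom.leftExact_iff_vanishing h.symm,
    WakamatsuDom.preservesMono_and_extExtVanishes_iff h.symm, WakamatsuDom.vanishing_comm h]
  -- After rewriting, all six statements are the same conjunction over `Γᵐᵒᵖ`.
  intro a ha b hb
  simp only [List.mem_cons, List.not_mem_nil, or_false, or_self] at ha hb
  rw [ha, hb]
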